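/- Let $\mathbb D$, $\mathbb T$, $\mathbb E$ denote the open unit disc, the unit circle and the complement of the closed unit disc in $\mathbb C$. Let $\mathfrak p=\mathfrak p_1\cdots\mathfrak p_s\in\mathbb C[z,w]$ be a square free polynomial with irreducible factors $\mathfrak p_j$ of bidegree $(n_j,m_j)$, and assume $\mathfrak p$ is inner toral, i.e. its zero set is contained in $\mathbb D^2\cup\mathbb T^2\cup\mathbb E^2$. A *pure isometry* is an isometry $S$ of a complex Hilbert space $\mathcal K$ with $\bigcap_{n} S^n\mathcal K=\{0\}$; its multiplicity is $\dim\ker S^*$. A *pure $\mathfrak p$-isopair* is a commuting pair $V=(S,T)$ of pure isometries of a Hilbert space such that $\mathfrak p(S,T)=0$ and $\mathfrak p$ divides every polynomial $q$ with $q(S,T)=0$. It has *finite bimultiplicity* if $S$ and $T$ have finite multiplicity. It has *rank* $\alpha=(\alpha_1,\dots,\alpha_s)$, a tuple of positive integers, if $\dim\ker T^*=\sum_j\alpha_jn_j$, $\dim\ker S^*=\sum_j\alpha_jm_j$, and $$\dim\bigl(\ker(S-\lambda)^*\cap\ker(T-\mu)^*\bigr)=\alpha_j$$ for every $j$ and every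 $(\lambda,\mu)\in\mathbb D^2$ with $\mathfrak p_j(\lambda,\mu)=0$ and $\nabla\mathfrak p(\lambda,\mu)\neq0$. For an integer $k\ge 0$, a pair $V=(S,T)$ on $\mathcal K$ is *$k$-cyclic* (respectively *nearly $k$-cyclic*) if there are $f_1,\dots,f_k\in\mathcal K$ such that the closure of $\{\sum_{i=1}^k q_i(S,T)f_i: q_i\in\mathbb C[z,w]\}$ is $\mathcal K$ (respectively has finite codimension in $\mathcal K$), and no set of $k-1$ vectors has this property. It is *at least $k$-cyclic* (respectively *at least nearly $k$-cyclic*) if it is not $\gamma$-cyclic (respectively not nearly $\gamma$-cyclic) for any $\gamma<k$. **Statement.** Let $V=(S,T)$ be a pure $\mathfrak p$-isopair of finite bimultiplicity with rank $\alpha$ on a Hilbert space $\mathcal K$, and let $\beta=\max\{\alpha_1,\dots,\alpha_s\}$ (with $\beta=0$ if $s=0$). 1. If $\mathcal H\subseteq\mathcal K$ is a closed subspace of finite codimension that is invariant under $S$ and $T$, then $W=V|_{\mathcal H}$ is a pure $\mathfrak p$-isopair of finite bimultiplicity, $W$ has rank $\alpha$, and $W$ is at least $\beta$-cyclic. 2.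 $V$ is at least nearly $\beta$-cyclic. -/

import Mathlib

/-- The value `q(S,T) = ∑ c_{a,b} S^a T^b` of a polynomial `q = ∑ c_{a,b} z^a w^b` in two variables
(`z` is the variable `0` and `w` is the variable `1`) at a pair of operators. -/
noncomputable def polyEval {K : Type*} [NormedAddCommGroup K] [InnerProductSpace ℂ K]
    (q : MvPolynomial (Fin 2) ℂ) (S T : K →L[ℂ] K) : K →L[ℂ] K :=
  ∑ m ∈ q.support, q.coeff m • (S ^ m 0 * T ^ m 1)

theorem polyEval_eq_sum {K : Type*} [NormedAddCommGroup K] [InnerProductSpace ℂ K]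
    (q : MvPolynomial (Fin 2) ℂ) (S T : K →L[ℂ] K) {A : Finset (Fin 2 →₀ ℕ)}
    (h : q.support ⊆ A) :
    polyEval q S T = ∑ m ∈ A, q.coeff m • (S ^ m 0 * T ^ m 1) := by
  unfold polyEval
  refine Finset.sum_subset h fun m _ hm => ?_
  rw [MvPolynomial.notMem_support_iff.mp hm, zero_smul]

theorem polyEval_add {K : Type*} [NormedAddCommGroup K] [InnerProductSpace ℂ K]
    (q r : MvPolynomial (Fin 2) ℂ) (S T : K →L[ℂ] K) :
    polyEval (q + r) S T = polyEval q S T + polyEval r S T := by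
  classical
  rw [polyEval_eq_sum (q + r) S T MvPolynomial.support_add,
    polyEval_eq_sum q S T (Finset.subset_union_left (s₂ := r.support)),
    polyEval_eq_sum r S T (Finset.subset_union_right (s₁ := q.support)),
    ← Finset.sum_add_distrib]
  simp only [MvPolynomial.coeff_add, add_smul]

theorem polyEval_smul {K : Type*} [NormedAddCommGroup K] [InnerProductSpace ℂ K]
    (c : ℂ) (q : MvPolynomial (Fin 2) ℂ) (S T : K →L[ℂ] K) :
    polyEval (c • q) S T = c • polyEval q S T := by
  rw [polyEval_eq_sum (c • q) S T MvPolynomial.support_smul, polyEval, Finset.smul_sum]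
  simp only [MvPolynomial.coeff_smul, smul_eq_mul, mul_smul]

/-- The zero set of `q` lies in `𝔻² ∪ 𝕋² ∪ 𝔼²`, where `𝔻` is the open unit disc, `𝕋` the unit
circle and `𝔼` the complement of the closed unit disc. -/
def IsInnerToral (q : MvPolynomial (Fin 2) ℂ) : Prop :=
  ∀ z w : ℂ, MvPolynomial.eval ![z, w] q = 0 →
    (‖z‖ < 1 ∧ ‖w‖ < 1) ∨ (‖z‖ = 1 ∧ ‖w‖ = 1) ∨ (1 < ‖z‖ ∧ 1 < ‖w‖)

/-- `(z, w)` is a regular point for `p`: `p` vanishes there but its gradient does not. -/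
def IsRegularPoint (p : MvPolynomial (Fin 2) ℂ) (z w : ℂ) : Prop :=
  MvPolynomial.eval ![z, w] p = 0 ∧
    (MvPolynomial.eval ![z, w] (MvPolynomial.pderiv 0 p) ≠ 0 ∨
      MvPolynomial.eval ![z, w] (MvPolynomial.pderiv 1 p) ≠ 0)

/-- The set `𝔙(q) = Z(q) ∩ 𝔻²`. -/
def zerosInBidisc (q : MvPolynomial (Fin 2) ℂ) : Set (ℂ × ℂ) :=
  {x | MvPolynomial.eval ![x.1, x.2] q = 0 ∧ ‖x.1‖ < 1 ∧ ‖x.2‖ < 1}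

section HilbertSpace

variable {K : Type*} [NormedAddCommGroup K] [InnerProductSpace ℂ K]

/-- An isometry without unitary part: `⋂ₙ Sⁿ K = {0}`. -/
structure IsPureIsometry (S : K →L[ℂ] K) : Prop where
  isometry : Isometry S
  iInf_range_pow : ⨅ n : ℕ, LinearMap.range ((S ^ n : K →L[ℂ] K) : K →ₗ[ℂ] K) = ⊥

/-- `(S, T)` is a pure `p`-isopair: a commuting pair of pure isometries for which `p` is
the minimal annihilating polynomial, i.e. `p(S,T) = 0` and `p` divides
every polynomial `q` with `q(S,T) = 0`. -/
structure IsPureIsopair (p : MvPolynomial (Fin 2) ℂ) (S T : K →L[ℂ] K) : Prop where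
  pure_left : IsPureIsometry S
  pure_right : IsPureIsometry T
  commute : Commute S T
  annihilates : polyEval p S T = 0
  minimal : ∀ q : MvPolynomial (Fin 2) ℂ, polyEval q S T = 0 → p ∣ q

/-- The multiplicity `dim ker S*` of an isometry `S`. -/
noncomputable def isoMult [CompleteSpace K] (S : K →L[ℂ] K) : Cardinal :=
  Module.rank ℂ (LinearMap.ker (ContinuousLinearMap.adjoint S : K →ₗ[ℂ] K))

/-- The bimultiplicity `(mult S, mult T)` is a pair of finite numbers. -/
def HasFiniteBimultiplicity [CompleteSpace K] (S T : K →L[ℂ] K) : Prop :=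
  isoMult S < Cardinal.aleph0 ∧ isoMult T < Cardinal.aleph0

/-- The joint eigenspace `ker (S - z)* ∩ ker (T - w)*`. -/
noncomputable def jointKer [CompleteSpace K] (S T : K →L[ℂ] K) (z w : ℂ) : Submodule ℂ K :=
  LinearMap.ker (ContinuousLinearMap.adjoint (S - z • (1 : K →L[ℂ] K)) : K →ₗ[ℂ] K) ⊓
    LinearMap.ker (ContinuousLinearMap.adjoint (T - w • (1 : K →L[ℂ] K)) : K →ₗ[ℂ] K)

/-- `α` is the rank of the pair `(S, T)` relative to the irreducible factors
`pf 0, …, pf (s-1)` of the polynomial `∏ j, pf j`: a tuple of positive integers such that, with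
`(n_j, m_j)` the bidegree of `pf j`, `mult T = ∑ α_j n_j`, `mult S = ∑ α_j m_j`, and
`dim (ker (S - z)* ∩ ker (T - w)*) = α_j` at every point of `𝔙(pf j)` that is a regular point
for `∏ j, pf j`. -/
structure HasRank [CompleteSpace K] {s : ℕ} (pf : Fin s → MvPolynomial (Fin 2) ℂ)
    (α : Fin s → ℕ) (S T : K →L[ℂ] K) : Prop where
  pos : ∀ j, 0 < α j
  mult_right : isoMult T = ((∑ j, α j * (pf j).degreeOf 0 : ℕ) : Cardinal)
  mult_left : isoMult S = ((∑ j, α j * (pf j).degreeOf 1 : ℕ) : Cardinal)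
  dim_eq : ∀ j, ∀ x ∈ zerosInBidisc (pf j), IsRegularPoint (∏ i, pf i) x.1 x.2 →
    Module.rank ℂ (jointKer S T x.1 x.2) = (α j : Cardinal)

/-- The subspace `{∑_j q_j(S,T) f_j : q_j ∈ ℂ[z,w]}`. -/
noncomputable def polySpan (S T : K →L[ℂ] K) {k : ℕ} (f : Fin k → K) : Submodule ℂ K where
  carrier := {x | ∃ q : Fin k → MvPolynomial (Fin 2) ℂ, x = ∑ j, polyEval (q j) S T (f j)}
  zero_mem' := ⟨0, by simp [polyEval]⟩
  add_mem' := by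
    rintro _ _ ⟨q, rfl⟩ ⟨r, rfl⟩
    exact ⟨q + r, by simp [polyEval_add, Finset.sum_add_distrib]⟩
  smul_mem' := by
    rintro c _ ⟨q, rfl⟩
    exact ⟨c • q, by simp [polyEval_smul, Finset.smul_sum]⟩

/-- Some `k` vectors (repetitions allowed) are cyclic for `(S, T)`. -/
def HasCyclicVectors (S T : K →L[ℂ] K) (k : ℕ) : Prop :=
  ∃ f : Fin k → K, (polySpan S T f).topologicalClosure = ⊤

/-- Some `k` vectors (repetitions allowed) generate a subspace whose closure has finite
codimension. -/
def HasNearlyCyclicVectors (S T : K →L[ℂ] K) (k : ℕ) : Prop :=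
  ∃ f : Fin k → K, FiniteDimensional ℂ (K ⧸ (polySpan S T f).topologicalClosure)

/-- `(S, T)` is `k`-cyclic: `k` vectors suffice, but no `k - 1` vectors do. -/
def IsMultiCyclic (S T : K →L[ℂ] K) (k : ℕ) : Prop :=
  HasCyclicVectors S T k ∧ ∀ m : ℕ, m + 1 = k → ¬ HasCyclicVectors S T m

/-- `(S, T)` is nearly `k`-cyclic: `k` vectors suffice, but no `k - 1` vectors do. -/
def IsNearlyMultiCyclic (S T : K →L[ℂ] K) (k : ℕ) : Prop :=
  HasNearlyCyclicVectors S T k ∧ ∀ m : ℕ, m + 1 = k → ¬ HasNearlyCyclicVectors S T m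

/-- `(S, T)` is not `γ`-cyclic for any `γ < k`. -/
def IsAtLeastMultiCyclic (S T : K →L[ℂ] K) (k : ℕ) : Prop :=
  ∀ γ < k, ¬ IsMultiCyclic S T γ

/-- `(S, T)` is not nearly `γ`-cyclic for any `γ < k`. -/
def IsAtLeastNearlyMultiCyclic (S T : K →L[ℂ] K) (k : ℕ) : Prop :=
  ∀ γ < k, ¬ IsNearlyMultiCyclic S T γ

/-- The restriction of an operator to an invariant subspace. -/
noncomputable def restrictOp (S : K →L[ℂ] K) (H : Submodule ℂ K) (hS : ∀ x ∈ H, S x ∈ H) :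
    H →L[ℂ] H :=
  S.restrict hS

end HilbertSpace

/-! The joint eigenspace of the adjoints at `(z, w)` is the orthogonal complement of `ran (S - z) +
ran (T - w)`, so the rank is a matter of cokernels. Let `x = S - z` and `y = T - w`, and let `H` be
invariant of finite codimension. The quotient `K / xH` is an extension of `K / xK` by `K / H`, and
also of `K / H` by `H / xH`. Both extensions respect `y`, and generalized null spaces are additive
in extensions, so `y` has equally large generalized null spaces on `K / xK` and `H / xH`
(`eventually_finrank_ker_mapQ_pow_eq`). At a regular point with nonzero `w`-derivative, `p(z, w +
t)` has a simple zero at `t = 0` and annihilates `y` on these quotients; hence the generalized null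
space is the kernel, whose dimension is that of the joint eigenspace. If the `z`-derivative is
nonzero, the operators trade places. Thus the rank survives restriction (`HasRank.restrictOp`).

If `k` vectors are cyclic, pairing with them embeds every joint eigenspace in `ℂ^k`
(`HasCyclicVectors.rank_jointKer_le`). Every factor has a regular zero in the bidisc
(`exists_isRegularPoint`), so `k ≥ β`. For near cyclicity this is applied to the closed invariant
subspace generated by the vectors. -/

open Filter

/-! ### Cokernels and generalized null spaces under finite-codimensional restriction -/

section FredholmIndex

variable {k A B C M M' : Type*} [Field k] [AddCommGroup A] [Module k A] [AddCommGroup B]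
  [Module k B] [AddCommGroup C] [Module k C] [AddCommGroup M] [Module k M]
  [AddCommGroup M'] [Module k M']

/-- Kernels are only left exact in general. The Fitting splittings of `yB` and `yC` give
surjectivity on kernels; the lemma is applied to high powers, where they hold. -/
theorem finrank_ker_eq_add_of_exact [FiniteDimensional k B]
    {f : A →ₗ[k] B} {g : B →ₗ[k] C} (hf : Function.Injective f) (hg : Function.Surjective g)
    (hfg : ∀ b, g b = 0 → ∃ a, f a = b) (hgf : ∀ a, g (f a) = 0)
    {yA : Module.End k A} {yB : Module.End k B} {yC : Module.End k C}
    (hfy : yB ∘ₗ f = f ∘ₗ yA) (hgy : yC ∘ₗ g = g ∘ₗ yB)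
    (hB : IsCompl (LinearMap.ker yB) (LinearMap.range yB))
    (hC : IsCompl (LinearMap.ker yC) (LinearMap.range yC)) :
    Module.finrank k (LinearMap.ker yB) =
      Module.finrank k (LinearMap.ker yA) + Module.finrank k (LinearMap.ker yC) := by
  have hfy' : ∀ a, yB (f a) = f (yA a) := fun a => LinearMap.congr_fun hfy a
  have hgy' : ∀ b, yC (g b) = g (yB b) := fun b => LinearMap.congr_fun hgy b
  have hmem : ∀ b ∈ LinearMap.ker yB, g b ∈ LinearMap.ker yC := fun b hb => by
    rw [LinearMap.mem_ker] at *
    rw [hgy', hb, map_zero]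
  have hmem' : ∀ a ∈ LinearMap.ker yA, f a ∈ LinearMap.ker yB := fun a ha => by
    rw [LinearMap.mem_ker] at *
    rw [hfy', ha, map_zero]
  set G := g.restrict hmem with hG
  set F := f.restrict hmem' with hF
  have hGs : LinearMap.range G = ⊤ := by
    rw [LinearMap.range_eq_top]
    rintro ⟨c, hc⟩
    obtain ⟨b, rfl⟩ := hg c
    obtain ⟨b₀, hb₀, b₁, ⟨d, rfl⟩, rfl⟩ :=
      Submodule.mem_sup.1 (hB.sup_eq_top ▸ Submodule.mem_top : b ∈ _)
    refine ⟨⟨b₀, hb₀⟩, Subtype.ext ?_⟩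
    -- Both `g b` and `g b₀` lie in `ker yC`, so their difference lies in `ker yC ⊓ range yC = ⊥`.
    have h0 : g (yB d) = 0 := by
      refine Submodule.disjoint_def.1 hC.disjoint _ ?_ ⟨g d, hgy' d⟩
      have := Submodule.sub_mem _ hc (hmem b₀ hb₀)
      simpa using this
    simp [hG, LinearMap.restrict_apply, h0]
  have hFi : Function.Injective F := fun a b hab => Subtype.ext (hf (congrArg Subtype.val hab))
  have hFr : LinearMap.range F = LinearMap.ker G := by
    ext ⟨b, hb⟩
    constructor
    · rintro ⟨a, ha⟩
      rw [← ha]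
      exact Subtype.ext (hgf a)
    · intro h
      obtain ⟨a, rfl⟩ := hfg b (congrArg Subtype.val h)
      refine ⟨⟨a, hf ?_⟩, rfl⟩
      rw [map_zero, ← hfy']
      exact hb
  rw [← LinearMap.finrank_range_add_finrank_ker G, hGs, finrank_top, ← hFr,
    LinearMap.finrank_range_of_inj hFi, add_comm]

theorem range_le_comap_range {x : Module.End k M} {y : Module.End k M} (h : Commute x y) :
    LinearMap.range x ≤ (LinearMap.range x).comap y := by
  rintro _ ⟨m, rfl⟩
  exact ⟨y m, LinearMap.congr_fun h.eq m⟩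

/-- Passing to an invariant subspace of finite codimension does not change the dimension of the
generalized null space of `y` on the cokernel of `x`. -/
theorem eventually_finrank_ker_mapQ_pow_eq {x y : Module.End k M} {x' y' : Module.End k M'}
    {ι : M' →ₗ[k] M} (hι : Function.Injective ι) (hx : x ∘ₗ ι = ι ∘ₗ x') (hy : y ∘ₗ ι = ι ∘ₗ y')
    (hxy : Commute x y) (hxy' : Commute x' y') (hxi : Function.Injective x)
    [FiniteDimensional k (M ⧸ LinearMap.range ι)] [FiniteDimensional k (M ⧸ LinearMap.range x)] :
    FiniteDimensional k (M' ⧸ LinearMap.range x') ∧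
    ∀ᶠ n in atTop,
      Module.finrank k (LinearMap.ker
        (((LinearMap.range x).mapQ _ y (range_le_comap_range hxy)) ^ n)) =
      Module.finrank k (LinearMap.ker
        (((LinearMap.range x').mapQ _ y' (range_le_comap_range hxy')) ^ n)) := by
  have hx' : ∀ a, x (ι a) = ι (x' a) := fun a => LinearMap.congr_fun hx a
  have hy' : ∀ a, y (ι a) = ι (y' a) := fun a => LinearMap.congr_fun hy a
  have hc : ∀ a, x (y a) = y (x a) := fun a => LinearMap.congr_fun hxy.eq a
  set R := LinearMap.range (x ∘ₗ ι) with hR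
  have h1 : LinearMap.range ι ≤ R.comap x := by
    rintro _ ⟨a, rfl⟩
    exact ⟨a, rfl⟩
  have h2 : R ≤ LinearMap.range x := LinearMap.range_comp_le_range _ _
  have h3 : LinearMap.range x' ≤ R.comap ι := by
    rintro _ ⟨a, rfl⟩
    exact ⟨a, hx' a⟩
  have h4 : R ≤ LinearMap.range ι := by
    rintro _ ⟨a, rfl⟩
    exact ⟨x' a, (hx' a).symm⟩
  have hyR : R ≤ R.comap y := by
    rintro _ ⟨a, rfl⟩
    exact ⟨y' a, by simp [← hy', hc]⟩
  have hyι : LinearMap.range ι ≤ (LinearMap.range ι).comap y := by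
    rintro _ ⟨a, rfl⟩
    exact ⟨y' a, (hy' a).symm⟩
  -- With `M'` viewed inside `M`, these are the sequences `0 → M/M' → M/xM' → M/xM → 0`, the first
  -- map being induced by `x`, and `0 → M'/xM' → M/xM' → M/M' → 0`.
  let f₁ := (LinearMap.range ι).mapQ R x h1
  let g₁ := R.mapQ (LinearMap.range x) LinearMap.id h2
  let f₂ := (LinearMap.range x').mapQ R ι h3
  let g₂ := R.mapQ (LinearMap.range ι) LinearMap.id h4
  have hf₁ : Function.Injective f₁ := by
    rw [← LinearMap.ker_eq_bot, LinearMap.ker_eq_bot']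
    intro a ha
    obtain ⟨a, rfl⟩ := Submodule.mkQ_surjective _ a
    obtain ⟨b, hb⟩ := (Submodule.Quotient.mk_eq_zero _).1 ha
    exact (Submodule.Quotient.mk_eq_zero _).2 ⟨b, hxi hb⟩
  have hf₂ : Function.Injective f₂ := by
    rw [← LinearMap.ker_eq_bot, LinearMap.ker_eq_bot']
    intro a ha
    obtain ⟨a, rfl⟩ := Submodule.mkQ_surjective _ a
    obtain ⟨b, hb⟩ := (Submodule.Quotient.mk_eq_zero _).1 ha
    exact (Submodule.Quotient.mk_eq_zero _).2 ⟨b, hι ((hx' b).symm.trans hb)⟩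
  have hg₁ : Function.Surjective g₁ := fun c => by
    obtain ⟨c, rfl⟩ := Submodule.mkQ_surjective _ c
    exact ⟨R.mkQ c, rfl⟩
  have hg₂ : Function.Surjective g₂ := fun c => by
    obtain ⟨c, rfl⟩ := Submodule.mkQ_surjective _ c
    exact ⟨R.mkQ c, rfl⟩
  have he₁ : ∀ b, g₁ b = 0 → ∃ a, f₁ a = b := fun b hb => by
    obtain ⟨b, rfl⟩ := Submodule.mkQ_surjective _ b
    obtain ⟨a, rfl⟩ := (Submodule.Quotient.mk_eq_zero _).1 hb
    exact ⟨(LinearMap.range ι).mkQ a, rfl⟩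
  have he₂ : ∀ b, g₂ b = 0 → ∃ a, f₂ a = b := fun b hb => by
    obtain ⟨b, rfl⟩ := Submodule.mkQ_surjective _ b
    obtain ⟨a, rfl⟩ := (Submodule.Quotient.mk_eq_zero _).1 hb
    exact ⟨(LinearMap.range x').mkQ a, rfl⟩
  have hz₁ : ∀ a, g₁ (f₁ a) = 0 := fun a => by
    obtain ⟨a, rfl⟩ := Submodule.mkQ_surjective _ a
    exact (Submodule.Quotient.mk_eq_zero _).2 ⟨a, rfl⟩
  have hz₂ : ∀ a, g₂ (f₂ a) = 0 := fun a => by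
    obtain ⟨a, rfl⟩ := Submodule.mkQ_surjective _ a
    exact (Submodule.Quotient.mk_eq_zero _).2 ⟨a, rfl⟩
  have hB : FiniteDimensional k (M ⧸ R) :=
    have := Module.Finite.equiv (Submodule.quotEquivOfEq _ _ (by
          ext b
          exact ⟨fun h => by obtain ⟨a, rfl⟩ := he₁ b h; exact ⟨a, rfl⟩,
            by rintro ⟨a, rfl⟩; exact hz₁ a⟩ : LinearMap.ker g₁ = LinearMap.range f₁) |>.symm.trans
          (g₁.quotKerEquivOfSurjective hg₁)).symm
    Module.Finite.of_submodule_quotient (LinearMap.range f₁)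
  have hA : FiniteDimensional k (M' ⧸ LinearMap.range x') :=
    Module.Finite.of_injective f₂ hf₂
  refine ⟨hA, ?_⟩
  set Y₁ := (LinearMap.range ι).mapQ _ y hyι
  set Y₂ := R.mapQ _ y hyR
  set Y₃ := (LinearMap.range x).mapQ _ y (range_le_comap_range hxy)
  set Y₄ := (LinearMap.range x').mapQ _ y' (range_le_comap_range hxy')
  filter_upwards [LinearMap.eventually_isCompl_ker_pow_range_pow Y₁,
    LinearMap.eventually_isCompl_ker_pow_range_pow Y₂,
    LinearMap.eventually_isCompl_ker_pow_range_pow Y₃] with n hn₁ hn₂ hn₃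
  have e₁ := finrank_ker_eq_add_of_exact hf₁ hg₁ he₁ hz₁
    (Module.End.commute_pow_left_of_commute (g := Y₁) (g₂ := Y₂) (f := f₁)
      (by ext a; exact congrArg R.mkQ (hc a).symm) n)
    (Module.End.commute_pow_left_of_commute (g := Y₂) (g₂ := Y₃) (f := g₁)
      (by ext a; rfl) n) hn₂ hn₃
  have e₂ := finrank_ker_eq_add_of_exact hf₂ hg₂ he₂ hz₂
    (Module.End.commute_pow_left_of_commute (g := Y₄) (g₂ := Y₂) (f := f₂)
      (by ext a; exact congrArg R.mkQ (hy' a)) n)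
    (Module.End.commute_pow_left_of_commute (g := Y₂) (g₂ := Y₁) (f := g₂)
      (by ext a; rfl) n) hn₂ hn₁
  omega

theorem finrank_quotient_range_eq {x : Module.End k M} {x' : Module.End k M'}
    {ι : M' →ₗ[k] M} (hι : Function.Injective ι) (hx : x ∘ₗ ι = ι ∘ₗ x')
    (hxi : Function.Injective x)
    [FiniteDimensional k (M ⧸ LinearMap.range ι)] [FiniteDimensional k (M ⧸ LinearMap.range x)] :
    Module.finrank k (M ⧸ LinearMap.range x) = Module.finrank k (M' ⧸ LinearMap.range x') := by
  obtain ⟨-, h⟩ := eventually_finrank_ker_mapQ_pow_eq (y := 0) (y' := 0) hι hx (by simp)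
    (Commute.zero_right x) (Commute.zero_right x') hxi
  -- For `y = 0` the generalized null space is the whole cokernel, provided `n ≠ 0`, since `0 ^ 0 =
  -- 1`.
  obtain ⟨n, hn, hn0⟩ := (h.and (eventually_ne_atTop 0)).exists
  have hz : ∀ (N : Submodule k M) (h : N ≤ N.comap 0), N.mapQ N (0 : Module.End k M) h = 0 :=
    fun N h => Submodule.mapQ_zero N N h
  have hz' : ∀ (N : Submodule k M') (h : N ≤ N.comap 0), N.mapQ N (0 : Module.End k M') h = 0 :=
    fun N h => Submodule.mapQ_zero N N h
  rw [hz, hz', zero_pow hn0, zero_pow hn0, LinearMap.ker_zero, LinearMap.ker_zero,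
    finrank_top, finrank_top] at hn
  exact hn

theorem ker_pow_eq_ker_of_aeval_eq_zero {y : Module.End k M} {P : Polynomial k}
    (hP : Polynomial.aeval y P = 0) (h0 : P.coeff 0 = 0) (h1 : P.coeff 1 ≠ 0) {n : ℕ}
    (hn : n ≠ 0) : LinearMap.ker (y ^ n) = LinearMap.ker y := by
  obtain ⟨Q, rfl⟩ := Polynomial.X_dvd_iff.2 h0
  have hQ : Q.coeff 0 ≠ 0 := by simpa [Polynomial.coeff_X_mul] using h1
  have hcop : IsCoprime ((Polynomial.X : Polynomial k) ^ (n - 1)) Q :=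
    IsCoprime.pow_left ((Polynomial.irreducible_X.coprime_iff_not_dvd).2
      fun h => hQ (Polynomial.X_dvd_iff.1 h))
  obtain ⟨a, b, hab⟩ := hcop
  refine le_antisymm (fun m hm => ?_) (fun m hm => ?_)
  -- Multiplied by `X`, the Bézout identity writes `X` as a combination of `X ^ n` and `P`, both of
  -- which kill `m`.
  · have e := congrArg (fun R => Polynomial.aeval y (Polynomial.X * R) m) hab
    have e1 : (Polynomial.X : Polynomial k) * (a * Polynomial.X ^ (n - 1) + b * Q) =
        a * Polynomial.X ^ n + b * (Polynomial.X * Q) := by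
      obtain ⟨n, rfl⟩ := Nat.exists_eq_succ_of_ne_zero hn
      simp only [Nat.succ_sub_one, pow_succ]
      ring
    simp only [e1, map_add, map_mul (Polynomial.aeval y) a, map_mul (Polynomial.aeval y) b, hP,
      mul_zero, add_zero, mul_one, Polynomial.aeval_X, Polynomial.aeval_X_pow, Module.End.mul_apply,
      LinearMap.mem_ker.1 hm, map_zero] at e
    exact e.symm
  · obtain ⟨n, rfl⟩ := Nat.exists_eq_succ_of_ne_zero hn
    rw [LinearMap.mem_ker] at *
    rw [pow_succ, Module.End.mul_apply, hm, map_zero]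

/-- The left side is the cokernel of `y` acting on `M / xM`; in finite dimension kernel and cokernel
have equal dimension. -/
theorem finrank_quotient_sup_range {x y : Module.End k M} (hxy : Commute x y)
    [FiniteDimensional k (M ⧸ LinearMap.range x)] :
    Module.finrank k (M ⧸ (LinearMap.range x ⊔ LinearMap.range y)) =
      Module.finrank k (LinearMap.ker
        ((LinearMap.range x).mapQ _ y (range_le_comap_range hxy))) := by
  set Y := (LinearMap.range x).mapQ _ y (range_le_comap_range hxy) with hY
  have h : LinearMap.range Y = (LinearMap.range y).map (LinearMap.range x).mkQ := by
    rw [hY, Submodule.range_mapQ]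
  have e := (Submodule.quotientQuotientEquivQuotientSup (LinearMap.range x)
    (LinearMap.range y)).finrank_eq
  rw [← h] at e
  have e1 := LinearMap.finrank_range_add_finrank_ker Y
  have e2 := Submodule.finrank_quotient_add_finrank (LinearMap.range Y)
  omega

theorem aeval_mapQ_mkQ {N : Submodule k M} {y : Module.End k M} (h : N ≤ N.comap y)
    (Q : Polynomial k) (m : M) :
    Polynomial.aeval (N.mapQ N y h) Q (N.mkQ m) = N.mkQ (Polynomial.aeval y Q m) := by
  induction Q using Polynomial.induction_on generalizing m with
  | C a => simp [Module.algebraMap_end_apply]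
  | add p q hp hq => simp only [map_add, LinearMap.add_apply, hp, hq]
  | monomial j a ih =>
    have := ih (y m)
    simpa [pow_succ, ← mul_assoc] using this

theorem aeval_mapQ_eq_zero {N : Submodule k M} {y : Module.End k M} (h : N ≤ N.comap y)
    {P : Polynomial k} (hP : ∀ m, Polynomial.aeval y P m ∈ N) :
    Polynomial.aeval (N.mapQ N y h) P = 0 := by
  ext m
  rw [LinearMap.comp_apply, aeval_mapQ_mkQ]
  exact (Submodule.Quotient.mk_eq_zero _).2 (hP m)

/-- If `P(y)` maps into the range of `x` for some polynomial `P` with a simple root at `0`, then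
`dim M / (x M + y M)` is inherited by invariant subspaces of finite codimension. -/
theorem finrank_quotient_sup_range_eq {x y : Module.End k M} {x' y' : Module.End k M'}
    {ι : M' →ₗ[k] M} (hι : Function.Injective ι) (hx : x ∘ₗ ι = ι ∘ₗ x') (hy : y ∘ₗ ι = ι ∘ₗ y')
    (hxy : Commute x y) (hxy' : Commute x' y') (hxi : Function.Injective x)
    [FiniteDimensional k (M ⧸ LinearMap.range ι)] [FiniteDimensional k (M ⧸ LinearMap.range x)]
    {P : Polynomial k} (h0 : P.coeff 0 = 0) (h1 : P.coeff 1 ≠ 0)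
    (hP : ∀ m, Polynomial.aeval y P m ∈ LinearMap.range x)
    (hP' : ∀ m, Polynomial.aeval y' P m ∈ LinearMap.range x') :
    Module.finrank k (M ⧸ (LinearMap.range x ⊔ LinearMap.range y)) =
      Module.finrank k (M' ⧸ (LinearMap.range x' ⊔ LinearMap.range y')) := by
  obtain ⟨hfin, h⟩ := eventually_finrank_ker_mapQ_pow_eq hι hx hy hxy hxy' hxi
  obtain ⟨n, hn, hn0⟩ := (h.and (eventually_ne_atTop 0)).exists
  rw [finrank_quotient_sup_range hxy, finrank_quotient_sup_range hxy',
    ← ker_pow_eq_ker_of_aeval_eq_zero (aeval_mapQ_eq_zero _ hP) h0 h1 hn0, hn,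
    ker_pow_eq_ker_of_aeval_eq_zero (aeval_mapQ_eq_zero _ hP') h0 h1 hn0]

end FredholmIndex

/-! ### Regular zeros of inner toral polynomials in the bidisc -/

section RegularPoints

/-- An irreducible polynomial `f` over a GCD domain and a polynomial that it does not divide
have no common root outside the zero set of some nonzero constant. -/
theorem exists_mul_add_mul_eq_C {R : Type*} [CommRing R] [IsDomain R] [IsGCDMonoid R]
    {f g : Polynomial R} (hf : Irreducible f) (hdeg : f.natDegree ≠ 0) (hfg : ¬ f ∣ g) :
    ∃ (a b : Polynomial R) (d : R), d ≠ 0 ∧ a * f + b * g = Polynomial.C d := by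
  let K := FractionRing R
  -- By Gauss's lemma `f` and `g` are coprime over the fraction field; denominators are then cleared
  -- in the Bézout identity.
  have hprim := hf.isPrimitive hdeg
  have hf' := (hprim.irreducible_iff_irreducible_map_fraction_map (K := K)).1 hf
  have hfg' := mt (hprim.dvd_iff_fraction_map_dvd_fraction_map K).2 hfg
  obtain ⟨a, b, hab⟩ := (hf'.coprime_iff_not_dvd).2 hfg'
  obtain ⟨c, hc, hca⟩ := IsLocalization.integerNormalization_spec (nonZeroDivisors R) a
  obtain ⟨e, he, heb⟩ := IsLocalization.integerNormalization_spec (nonZeroDivisors R) b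
  set a' := IsLocalization.integerNormalization (nonZeroDivisors R) a
  set b' := IsLocalization.integerNormalization (nonZeroDivisors R) b
  refine ⟨Polynomial.C e * a', Polynomial.C c * b', c * e,
    mul_ne_zero (nonZeroDivisors.ne_zero hc) (nonZeroDivisors.ne_zero he), ?_⟩
  apply Polynomial.map_injective (algebraMap R K) (IsFractionRing.injective R K)
  rw [Polynomial.map_add, Polynomial.map_mul, Polynomial.map_mul, Polynomial.map_mul,
    Polynomial.map_mul, hca, heb, Polynomial.map_C, Polynomial.map_C, Polynomial.map_C,
    Algebra.smul_def, Algebra.smul_def, Polynomial.algebraMap_apply, Polynomial.algebraMap_apply,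
    map_mul, Polynomial.C_mul]
  linear_combination (Polynomial.C (algebraMap R K c) * Polynomial.C (algebraMap R K e)) * hab

theorem exists_mem_disc_eval_ne_zero {d : MvPolynomial (Fin 1) ℂ} (hd : d ≠ 0) :
    ∃ w : ℂ, ‖w‖ < 1 ∧ MvPolynomial.eval ![w] d ≠ 0 := by
  by_contra! h
  have hinf : (Metric.ball (0 : ℂ) 1).Infinite :=
    infinite_of_mem_nhds 0 (Metric.ball_mem_nhds 0 one_pos)
  apply hd
  apply MvPolynomial.funext_set (fun _ => Metric.ball (0 : ℂ) 1) (fun _ => hinf)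
  intro x hx
  have h0 : x = ![x 0] := by
    ext i
    fin_cases i
    rfl
  rw [h0, h _ (by simpa using hx 0 trivial), map_zero]

theorem finSuccEquiv_pderiv_zero {n : ℕ} (q : MvPolynomial (Fin (n + 1)) ℂ) :
    MvPolynomial.finSuccEquiv ℂ n (MvPolynomial.pderiv 0 q) =
      Polynomial.derivative (MvPolynomial.finSuccEquiv ℂ n q) := by
  induction q using MvPolynomial.induction_on with
  | C a => simp [MvPolynomial.finSuccEquiv_apply]
  | add p q hp hq => simp [hp, hq]
  | mul_X p i hp =>
    rw [Derivation.leibniz, smul_eq_mul, smul_eq_mul, map_add, map_mul, map_mul, map_mul, hp,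
      Polynomial.derivative_mul]
    refine Fin.cases ?_ (fun j => ?_) i
    · rw [MvPolynomial.pderiv_X_self, MvPolynomial.finSuccEquiv_X_zero, map_one,
        Polynomial.derivative_X]
      ring
    · rw [MvPolynomial.pderiv_X_of_ne (Fin.succ_ne_zero j), MvPolynomial.finSuccEquiv_X_succ,
        Polynomial.derivative_C, map_zero]
      ring

theorem eval_pair_eq (q : MvPolynomial (Fin 2) ℂ) (z w : ℂ) :
    MvPolynomial.eval ![z, w] q =
      Polynomial.eval z (Polynomial.map (MvPolynomial.eval ![w]) (MvPolynomial.finSuccEquiv ℂ 1 q)) :=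
  MvPolynomial.eval_eq_eval_mv_eval' ![w] z q

/-- An irreducible polynomial in `w` alone vanishes on a whole line `ℂ × {w}`. Inner torality at
`(0, w)` forces `‖w‖ < 1`, and at `(1, w)` it forces `‖w‖ = 1`. -/
theorem IsInnerToral.natDegree_ne_zero {q : MvPolynomial (Fin 2) ℂ} (hq : Irreducible q)
    (ht : IsInnerToral q) : (MvPolynomial.finSuccEquiv ℂ 1 q).natDegree ≠ 0 := by
  intro h
  obtain ⟨c, hc⟩ : ∃ c, MvPolynomial.finSuccEquiv ℂ 1 q = Polynomial.C c :=
    ⟨_, Polynomial.eq_C_of_natDegree_eq_zero h⟩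
  have hirr : Irreducible (MvPolynomial.finSuccEquiv ℂ 1 q) :=
    (MulEquiv.irreducible_iff (MvPolynomial.finSuccEquiv ℂ 1)).2 hq
  rw [hc] at hirr
  set e := MvPolynomial.uniqueAlgEquiv ℂ (Fin 1) with he
  have hdeg : (e c).degree ≠ 0 := by
    intro hd
    have hu : IsUnit (e c) := Polynomial.isUnit_iff_degree_eq_zero.2 hd
    have hu' : IsUnit c := (MulEquiv.isUnit_map e).1 hu
    exact hirr.not_isUnit (hu'.map Polynomial.C)
  obtain ⟨w, hw⟩ := IsAlgClosed.exists_root (e c) hdeg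
  have hroot : MvPolynomial.eval ![w] c = 0 := by
    have key : ∀ c : MvPolynomial (Fin 1) ℂ, MvPolynomial.eval ![w] c = Polynomial.eval w (e c) := by
      intro c
      induction c using MvPolynomial.induction_on with
      | C a => simp [he]
      | add p q hp hq => simp [hp, hq]
      | mul_X p i hp =>
        rw [map_mul, map_mul, hp, Polynomial.eval_mul]
        fin_cases i
        simp [he]
    rw [key]
    exact hw
  have hz : ∀ z, MvPolynomial.eval ![z, w] q = 0 := fun z => by
    rw [eval_pair_eq, hc, Polynomial.map_C, hroot, Polynomial.C_0, Polynomial.eval_zero]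
  have h0 := ht 0 w (hz 0)
  have h1 := ht 1 w (hz 1)
  simp only [norm_zero, norm_one] at h0 h1
  rcases h0 with h0 | h0 | h0
  · rcases h1 with h1 | h1 | h1 <;> linarith [h1.1, h1.2, h0.2]
  · linarith [h0.1]
  · linarith [h0.1]

theorem IsInnerToral.of_dvd {p q : MvPolynomial (Fin 2) ℂ} (hp : IsInnerToral p) (h : q ∣ p) :
    IsInnerToral q := by
  obtain ⟨r, rfl⟩ := h
  intro z w hzw
  exact hp z w (by rw [map_mul, hzw, zero_mul])

theorem IsInnerToral.exists_mem_zerosInBidisc {q g : MvPolynomial (Fin 2) ℂ} (hq : Irreducible q)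
    (ht : IsInnerToral q) (hg : ¬ q ∣ g) :
    ∃ x ∈ zerosInBidisc q, MvPolynomial.eval ![x.1, x.2] g ≠ 0 := by
  set φ := MvPolynomial.finSuccEquiv ℂ 1 with hφ
  have hdeg := ht.natDegree_ne_zero hq
  have hirr : Irreducible (φ q) := (MulEquiv.irreducible_iff φ).2 hq
  obtain ⟨a, b, d, hd, hab⟩ := exists_mul_add_mul_eq_C hirr hdeg
    (fun h => hg ((map_dvd_iff φ).1 h))
  -- The leading coefficient stays nonzero so that `q(·, w)` still has a root, which inner torality
  -- puts in the disc. Since `d(w) ≠ 0`, the polynomial `g` cannot vanish there too.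
  obtain ⟨w, hw, hdw⟩ := exists_mem_disc_eval_ne_zero
    (mul_ne_zero hd (Polynomial.leadingCoeff_ne_zero.2 hirr.ne_zero))
  rw [map_mul] at hdw
  have hmap : ((φ q).map (MvPolynomial.eval ![w])).degree ≠ 0 := by
    rw [Polynomial.degree_map_eq_of_leadingCoeff_ne_zero _ (right_ne_zero_of_mul hdw)]
    exact fun h => hdeg (Polynomial.natDegree_eq_of_degree_eq_some h)
  obtain ⟨z, hz⟩ := IsAlgClosed.exists_root _ hmap
  have hz0 : MvPolynomial.eval ![z, w] q = 0 := (eval_pair_eq q z w).trans hz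
  refine ⟨(z, w), ⟨hz0, ?_, hw⟩, fun h => left_ne_zero_of_mul hdw ?_⟩
  · rcases ht z w hz0 with h | h | h
    · exact h.1
    · linarith [h.2]
    · linarith [h.2]
  · have e := congrArg (fun f => Polynomial.eval z (Polynomial.map (MvPolynomial.eval ![w]) f)) hab
    have h' := eval_pair_eq g z w
    simp only [Polynomial.map_add, Polynomial.map_mul, Polynomial.eval_add, Polynomial.eval_mul,
      Polynomial.map_C, Polynomial.eval_C] at e
    rw [← h', h, ← eval_pair_eq q z w, hz0] at e
    simpa using e.symm

/-- Each irreducible factor of a square free inner toral polynomial has a zero in the bidisc which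
is a regular point of the whole polynomial. -/
theorem exists_isRegularPoint {s : ℕ} {pf : Fin s → MvPolynomial (Fin 2) ℂ}
    (hsq : Squarefree (∏ i, pf i)) (ht : IsInnerToral (∏ i, pf i))
    (hirr : ∀ j, Irreducible (pf j)) (j : Fin s) :
    ∃ x ∈ zerosInBidisc (pf j), IsRegularPoint (∏ i, pf i) x.1 x.2 := by
  obtain ⟨r, hr⟩ := Finset.dvd_prod_of_mem pf (Finset.mem_univ j)
  have hj := hirr j
  have htj := ht.of_dvd (Dvd.intro _ hr.symm)
  rw [hr] at hsq ⊢
  have h1 : ¬ pf j ∣ r := fun h => hj.not_isUnit (hsq _ (mul_dvd_mul_left _ h))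
  have h2 : ¬ pf j ∣ MvPolynomial.pderiv 0 (pf j) := by
    intro h
    have hdeg := htj.natDegree_ne_zero hj
    have h' := (map_dvd_iff (MvPolynomial.finSuccEquiv ℂ 1)).2 h
    rw [finSuccEquiv_pderiv_zero] at h'
    have hne : Polynomial.derivative (MvPolynomial.finSuccEquiv ℂ 1 (pf j)) ≠ 0 := fun h0 =>
      hdeg (Polynomial.derivative_eq_zero.1 h0)
    exact absurd (Polynomial.natDegree_le_of_dvd h' hne)
      (not_le.2 (Polynomial.natDegree_derivative_lt hdeg))
  -- On the zero set of `pf j`, the `z`-derivative of `pf j * r` is `r` times that of `pf j`.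
  obtain ⟨x, hx, hxg⟩ := htj.exists_mem_zerosInBidisc hj
    (g := r * MvPolynomial.pderiv 0 (pf j)) (fun h => (hj.prime.dvd_or_dvd h).elim h1 h2)
  refine ⟨x, hx, by rw [map_mul, hx.1, zero_mul], Or.inl ?_⟩
  rw [Derivation.leibniz, smul_eq_mul, smul_eq_mul, map_add, map_mul, hx.1, zero_mul, zero_add]
  exact hxg

end RegularPoints

/-! ### Low-order coefficients after substituting one-variable polynomials -/

section PolynomialSubstitution

theorem coeff_zero_aeval (x : Fin 2 → Polynomial ℂ) (q : MvPolynomial (Fin 2) ℂ) :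
    (MvPolynomial.aeval x q).coeff 0 = MvPolynomial.eval (fun i => (x i).coeff 0) q := by
  induction q using MvPolynomial.induction_on with
  | C a => simp
  | add p q hp hq => simp [hp, hq]
  | mul_X p i hp => simp [hp]

theorem derivative_aeval (x : Fin 2 → Polynomial ℂ) (q : MvPolynomial (Fin 2) ℂ) :
    Polynomial.derivative (MvPolynomial.aeval x q) =
      ∑ i, MvPolynomial.aeval x (MvPolynomial.pderiv i q) * Polynomial.derivative (x i) := by
  induction q using MvPolynomial.induction_on with
  | C a => simp
  | add p q hp hq => simp [hp, hq, add_mul, Finset.sum_add_distrib]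
  | mul_X p j hp =>
    rw [Fin.sum_univ_two] at hp ⊢
    rw [map_mul, MvPolynomial.aeval_X, Polynomial.derivative_mul, hp]
    simp only [Derivation.leibniz, smul_eq_mul, map_add, map_mul, MvPolynomial.aeval_X]
    fin_cases j
    · simp
      ring
    · simp
      ring

theorem coeff_one_aeval (x : Fin 2 → Polynomial ℂ) (q : MvPolynomial (Fin 2) ℂ) :
    (MvPolynomial.aeval x q).coeff 1 =
      ∑ i, MvPolynomial.eval (fun i => (x i).coeff 0) (MvPolynomial.pderiv i q) *
        (x i).coeff 1 := by
  have h : ∀ P : Polynomial ℂ, P.coeff 1 = (Polynomial.derivative P).coeff 0 := fun P => by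
    simp [Polynomial.coeff_derivative]
  rw [h, derivative_aeval, Polynomial.finsetSum_coeff]
  exact Finset.sum_congr rfl fun i _ => by
    rw [Polynomial.mul_coeff_zero, coeff_zero_aeval, h (x i)]

end PolynomialSubstitution

/-! ### Pure isometries and the relation `p(S, T) = 0` modulo a range -/

section IsometryLemmas

variable {K : Type*} [NormedAddCommGroup K] [InnerProductSpace ℂ K]

theorem polyEval_apply (q : MvPolynomial (Fin 2) ℂ) (S T : K →L[ℂ] K) (v : K) :
    polyEval q S T v = ∑ m ∈ q.support, q.coeff m • (S ^ m 0) ((T ^ m 1) v) := by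
  simp [polyEval]

/-- An eigenvector with nonzero eigenvalue lies in the range of every power of `S`, which purity
excludes. -/
theorem IsPureIsometry.injective_sub_smul {S : K →L[ℂ] K} (hS : IsPureIsometry S) (c : ℂ) :
    Function.Injective (S - c • (1 : K →L[ℂ] K)) := by
  rw [injective_iff_map_eq_zero]
  intro v hv
  have hv' : S v = c • v := by simpa [sub_eq_zero] using hv
  rcases eq_or_ne c 0 with rfl | hc
  · exact hS.isometry.injective (by simpa using hv')
  · have hpow : ∀ n : ℕ, (S ^ n) v = c ^ n • v := by
      intro n
      induction n with
      | zero => simp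
      | succ n ih => rw [pow_succ', mul_apply_eq_comp, ih, map_smul, hv', smul_smul,
          pow_succ]
    have hmem : v ∈ ⨅ n : ℕ, LinearMap.range ((S ^ n : K →L[ℂ] K) : K →ₗ[ℂ] K) := by
      rw [Submodule.mem_iInf]
      intro n
      refine ⟨(c ^ n)⁻¹ • v, ?_⟩
      rw [ContinuousLinearMap.coe_coe, map_smul, hpow, smul_smul,
        inv_mul_cancel₀ (pow_ne_zero n hc), one_smul]
    rw [hS.iInf_range_pow] at hmem
    exact (Submodule.mem_bot ℂ).1 hmem

theorem IsPureIsometry.injective_aeval {S : K →L[ℂ] K} (hS : IsPureIsometry S)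
    {g : Polynomial ℂ} (hg : g ≠ 0) :
    Function.Injective (Polynomial.aeval (S : Module.End ℂ K) g) := by
  rw [(IsAlgClosed.splits g).eq_prod_roots, map_mul]
  refine Function.Injective.comp (g := ⇑(Polynomial.aeval (S : Module.End ℂ K) _)) ?_ ?_
  · rw [Polynomial.aeval_C]
    intro v w h
    exact smul_right_injective K (Polynomial.leadingCoeff_ne_zero.2 hg) h
  · induction g.roots using Multiset.induction_on with
    | empty =>
      rw [Multiset.map_zero, Multiset.prod_zero, map_one]
      exact Function.injective_id
    | cons a r ih =>
      rw [Multiset.map_cons, Multiset.prod_cons, map_mul]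
      refine Function.Injective.comp (g := ⇑(Polynomial.aeval (S : Module.End ℂ K) _)) ?_ ih
      intro v w h
      refine hS.injective_sub_smul a ?_
      simpa [Module.algebraMap_end_apply] using h

theorem polyEval_aeval_apply {S T : K →L[ℂ] K} (h : Commute S T) (q : MvPolynomial (Fin 2) ℂ)
    (g : Polynomial ℂ) (v : K) :
    polyEval q S T (Polynomial.aeval (S : Module.End ℂ K) g v) =
      Polynomial.aeval (S : Module.End ℂ K) g (polyEval q S T v) := by
  have hc : Commute (polyEval q S T) S := by
    refine Commute.sum_left _ _ _ fun m _ => ((Commute.mul_left ?_ ?_).smul_left _)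
    · exact (Commute.refl S).pow_left _
    · exact h.symm.pow_left _
  induction g using Polynomial.induction_on generalizing v with
  | C a => simp [Module.algebraMap_end_apply]
  | add p r hp hr => simp only [map_add, LinearMap.add_apply, hp, hr]
  | monomial j a ih =>
    have e := ih (S v)
    have e' := DFunLike.congr_fun hc.eq v
    rw [mul_apply_eq_comp, mul_apply_eq_comp] at e'
    rw [e'] at e
    simpa [pow_succ, ← mul_assoc] using e

theorem pow_apply_sub_smul_mem_range (S : K →L[ℂ] K) (z : ℂ) (n : ℕ) (v : K) :
    (S ^ n) v - z ^ n • v ∈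
      LinearMap.range ((S - z • (1 : K →L[ℂ] K) : K →L[ℂ] K) : K →ₗ[ℂ] K) := by
  have h : Commute S (z • (1 : K →L[ℂ] K)) := (Commute.one_right S).smul_right z
  obtain ⟨R, hR⟩ := h.sub_dvd_pow_sub_pow n
  refine ⟨R v, ?_⟩
  have := DFunLike.congr_fun hR v
  simpa [smul_pow] using this.symm

/-- Modulo `ran (S - z)` the operator `S` acts as `z`, so `p(S, T) = 0` becomes `p(z, T) = 0`,
rewritten in powers of `T - w`. -/
theorem aeval_mem_range_left {S T : K →L[ℂ] K} {p : MvPolynomial (Fin 2) ℂ}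
    (hp : polyEval p S T = 0) (z w : ℂ) (v : K) :
    Polynomial.aeval ((T - w • (1 : K →L[ℂ] K) : K →L[ℂ] K) : Module.End ℂ K)
      (MvPolynomial.aeval ![Polynomial.C z, Polynomial.X + Polynomial.C w] p) v ∈
      LinearMap.range ((S - z • (1 : K →L[ℂ] K) : K →L[ℂ] K) : K →ₗ[ℂ] K) := by
  have hT : Polynomial.aeval ((T - w • (1 : K →L[ℂ] K) : K →L[ℂ] K) : Module.End ℂ K)
      (Polynomial.X + Polynomial.C w) = (T : Module.End ℂ K) := by
    ext u
    simp [Module.algebraMap_end_apply]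
  have hpow : ∀ n u, ((T : Module.End ℂ K) ^ n) u = (T ^ n) u := fun n u => by
    rw [← ContinuousLinearMap.toLinearMap_pow]; rfl
  have e : Polynomial.aeval ((T - w • (1 : K →L[ℂ] K) : K →L[ℂ] K) : Module.End ℂ K)
      (MvPolynomial.aeval ![Polynomial.C z, Polynomial.X + Polynomial.C w] p) v =
      ∑ m ∈ p.support, p.coeff m • z ^ m 0 • (T ^ m 1) v := by
    rw [MvPolynomial.aeval_def, MvPolynomial.eval₂_eq', map_sum, LinearMap.sum_apply]
    refine Finset.sum_congr rfl fun m _ => ?_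
    simp only [Fin.prod_univ_two, Matrix.cons_val_zero, Matrix.cons_val_one, map_mul, map_pow, hT,
      Polynomial.algebraMap_apply, Algebra.algebraMap_self, RingHom.id_apply, Polynomial.aeval_C,
      Module.End.mul_apply, hpow]
    rw [← map_pow]
    rfl
  have e' := polyEval_apply p S T v
  rw [hp, zero_apply] at e'
  rw [e, ← neg_mem_iff, ← zero_sub, e', ← Finset.sum_sub_distrib]
  refine Submodule.sum_mem _ fun m _ => ?_
  rw [← smul_sub]
  exact Submodule.smul_mem _ _ (pow_apply_sub_smul_mem_range S z _ _)

theorem aeval_mem_range_right {S T : K →L[ℂ] K} (hc : Commute S T) {p : MvPolynomial (Fin 2) ℂ}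
    (hp : polyEval p S T = 0) (z w : ℂ) (v : K) :
    Polynomial.aeval ((S - z • (1 : K →L[ℂ] K) : K →L[ℂ] K) : Module.End ℂ K)
      (MvPolynomial.aeval ![Polynomial.X + Polynomial.C z, Polynomial.C w] p) v ∈
      LinearMap.range ((T - w • (1 : K →L[ℂ] K) : K →L[ℂ] K) : K →ₗ[ℂ] K) := by
  have hS : Polynomial.aeval ((S - z • (1 : K →L[ℂ] K) : K →L[ℂ] K) : Module.End ℂ K)
      (Polynomial.X + Polynomial.C z) = (S : Module.End ℂ K) := by
    ext u
    simp [Module.algebraMap_end_apply]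
  have hpow : ∀ n u, ((S : Module.End ℂ K) ^ n) u = (S ^ n) u := fun n u => by
    rw [← ContinuousLinearMap.toLinearMap_pow]; rfl
  have e : Polynomial.aeval ((S - z • (1 : K →L[ℂ] K) : K →L[ℂ] K) : Module.End ℂ K)
      (MvPolynomial.aeval ![Polynomial.X + Polynomial.C z, Polynomial.C w] p) v =
      ∑ m ∈ p.support, p.coeff m • w ^ m 1 • (S ^ m 0) v := by
    rw [MvPolynomial.aeval_def, MvPolynomial.eval₂_eq', map_sum, LinearMap.sum_apply]
    refine Finset.sum_congr rfl fun m _ => ?_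
    simp only [Fin.prod_univ_two, Matrix.cons_val_zero, Matrix.cons_val_one, map_mul, map_pow, hS,
      Polynomial.algebraMap_apply, Algebra.algebraMap_self, RingHom.id_apply, Polynomial.aeval_C,
      Module.End.mul_apply, hpow]
    rw [← map_pow]
    exact congrArg (p.coeff m • ·) ((S ^ m 0).map_smul (w ^ m 1) v)
  have e' := polyEval_apply p S T v
  rw [hp, zero_apply] at e'
  rw [e, ← neg_mem_iff, ← zero_sub, e', ← Finset.sum_sub_distrib]
  refine Submodule.sum_mem _ fun m _ => ?_
  rw [← smul_sub, ← mul_apply_eq_comp, (hc.pow_pow _ _).eq,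
    mul_apply_eq_comp]
  exact Submodule.smul_mem _ _ (pow_apply_sub_smul_mem_range T w _ _)

end IsometryLemmas

/-! ### Joint eigenspaces as cokernels -/

section CokernelDimension

variable {K : Type*} [NormedAddCommGroup K] [InnerProductSpace ℂ K]

theorem isClosed_range_sub_smul [CompleteSpace K] {S : K →L[ℂ] K} (hS : Isometry S) {z : ℂ}
    (hz : ‖z‖ < 1) :
    IsClosed (LinearMap.range ((S - z • (1 : K →L[ℂ] K) : K →L[ℂ] K) : K →ₗ[ℂ] K) : Set K) := by
  have hpos : 0 < 1 - ‖z‖ := by linarith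
  have hanti : AntilipschitzWith (Real.toNNReal (1 - ‖z‖)⁻¹) (S - z • (1 : K →L[ℂ] K)) := by
    refine AddMonoidHomClass.antilipschitz_of_bound _ fun v => ?_
    rw [Real.coe_toNNReal _ (inv_nonneg.2 hpos.le), inv_mul_eq_div, le_div_iff₀ hpos]
    have h1 : ‖S v‖ = ‖v‖ := hS.norm_map_of_map_zero (map_zero S) v
    have h2 := norm_sub_norm_le (S v) (z • v)
    rw [norm_smul, h1] at h2
    have h3 : (S - z • (1 : K →L[ℂ] K)) v = S v - z • v := by simp
    rw [h3]
    linarith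
  exact hanti.isClosed_range (S - z • (1 : K →L[ℂ] K)).uniformContinuous

theorem rank_orthogonal_eq_rank_quotient [CompleteSpace K] {R : Submodule ℂ K}
    (hR : IsClosed (R : Set K)) : Module.rank ℂ Rᗮ = Module.rank ℂ (K ⧸ R) := by
  have : CompleteSpace R := hR.completeSpace_coe
  exact (Submodule.quotientEquivOfIsCompl R Rᗮ R.isCompl_orthogonal).rank_eq.symm

theorem isoMult_eq_rank_quotient [CompleteSpace K] {S : K →L[ℂ] K} (hS : Isometry S) :
    isoMult S = Module.rank ℂ (K ⧸ LinearMap.range (S : K →ₗ[ℂ] K)) := by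
  have h := isClosed_range_sub_smul hS (z := 0) (by simp)
  rw [zero_smul, sub_zero] at h
  rw [← rank_orthogonal_eq_rank_quotient h]
  exact congrArg (fun N : Submodule ℂ K => Module.rank ℂ N) S.orthogonal_range.symm

theorem finiteDimensional_quotient_range_sub_smul [CompleteSpace K] {S : K →L[ℂ] K}
    (hS : Isometry S) (hm : isoMult S < Cardinal.aleph0) {z : ℂ} (hz : ‖z‖ < 1) :
    FiniteDimensional ℂ
      (K ⧸ LinearMap.range ((S - z • (1 : K →L[ℂ] K) : K →L[ℂ] K) : K →ₗ[ℂ] K)) := by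
  have hfin : FiniteDimensional ℂ
      (LinearMap.ker (ContinuousLinearMap.adjoint S : K →ₗ[ℂ] K)) :=
    Module.rank_lt_aleph0_iff.1 hm
  have hnorm : ∀ v, ‖S v‖ = ‖v‖ := fun v => hS.norm_map_of_map_zero (map_zero S) v
  have hSS : ∀ v, ContinuousLinearMap.adjoint S (S v) = v := fun v =>
    DFunLike.congr_fun ((ContinuousLinearMap.norm_map_iff_adjoint_comp_self S).1 hnorm) v
  set A := ContinuousLinearMap.adjoint (S - z • (1 : K →L[ℂ] K)) with hA
  have hAv : ∀ v, A v = ContinuousLinearMap.adjoint S v - (starRingEnd ℂ) z • v := fun v => by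
    have : ContinuousLinearMap.adjoint (1 : K →L[ℂ] K) = 1 :=
      ContinuousLinearMap.adjoint_id
    rw [hA, map_sub, map_smulₛₗ, this]
    simp
  -- Since `S*S = 1`, `S*F = (S - z)*`, so `F` carries `ker (S - z)*` into `ker S*`; it is injective
  -- because `‖z‖ < 1`.
  let F : K →ₗ[ℂ] K := LinearMap.id - (starRingEnd ℂ) z • (S : K →ₗ[ℂ] K)
  have hF : ∀ v, F v = v - (starRingEnd ℂ) z • S v := fun v => rfl
  have hmem : ∀ v ∈ LinearMap.ker (A : K →ₗ[ℂ] K),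
      F v ∈ LinearMap.ker (ContinuousLinearMap.adjoint S : K →ₗ[ℂ] K) := by
    intro v hv
    have hv' : A v = 0 := hv
    rw [LinearMap.mem_ker, hF, map_sub, map_smul, ContinuousLinearMap.coe_coe, hSS, ← hAv, hv']
  have hinj : Function.Injective (F.restrict hmem) := by
    rw [injective_iff_map_eq_zero]
    rintro ⟨v, hv⟩ h
    have h' : F v = 0 := congrArg Subtype.val h
    rw [hF, sub_eq_zero] at h'
    have hn := congrArg norm h'
    rw [norm_smul, hnorm, RCLike.norm_conj] at hn
    have : ‖v‖ = 0 := by nlinarith [norm_nonneg v]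
    exact Subtype.ext (norm_eq_zero.1 this)
  have hfinA : FiniteDimensional ℂ (LinearMap.ker (A : K →ₗ[ℂ] K)) :=
    Module.Finite.of_injective _ hinj
  rw [FiniteDimensional, ← Module.rank_lt_aleph0_iff,
    ← rank_orthogonal_eq_rank_quotient (isClosed_range_sub_smul hS hz)]
  have e := (S - z • (1 : K →L[ℂ] K)).orthogonal_range
  have : Module.rank ℂ (LinearMap.ker (A : K →ₗ[ℂ] K)) < Cardinal.aleph0 :=
    Module.rank_lt_aleph0_iff.2 hfinA
  rw [← hA] at e
  exact (congrArg (fun N : Submodule ℂ K => Module.rank ℂ N) e).trans_lt this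

theorem rank_jointKer_eq [CompleteSpace K] {S : K →L[ℂ] K} (T : K →L[ℂ] K)
    (hS : Isometry S) (hm : isoMult S < Cardinal.aleph0) {z : ℂ} (hz : ‖z‖ < 1) (w : ℂ) :
    Module.rank ℂ (jointKer S T z w) =
      (Module.finrank ℂ
        (K ⧸ (LinearMap.range ((S - z • (1 : K →L[ℂ] K) : K →L[ℂ] K) : K →ₗ[ℂ] K) ⊔
          LinearMap.range ((T - w • (1 : K →L[ℂ] K) : K →L[ℂ] K) : K →ₗ[ℂ] K))) : Cardinal) := by
  have hfin := finiteDimensional_quotient_range_sub_smul hS hm hz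
  set R₁ := LinearMap.range ((S - z • (1 : K →L[ℂ] K) : K →L[ℂ] K) : K →ₗ[ℂ] K) with hR₁
  set R₂ := LinearMap.range ((T - w • (1 : K →L[ℂ] K) : K →L[ℂ] K) : K →ₗ[ℂ] K) with hR₂
  -- The sum contains the closed subspace `R₁` of finite codimension.
  have hcl : IsClosed ((R₁ ⊔ R₂ : Submodule ℂ K) : Set K) :=
    Submodule.isClosed_mono_of_finiteDimensional_quotient (isClosed_range_sub_smul hS hz)
      le_sup_left
  have hfin' : FiniteDimensional ℂ (K ⧸ (R₁ ⊔ R₂)) :=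
    Module.Finite.of_surjective (Submodule.factor (le_sup_left : R₁ ≤ R₁ ⊔ R₂))
      (Submodule.factor_surjective _)
  have e : jointKer S T z w = (R₁ ⊔ R₂)ᗮ := by
    rw [← Submodule.inf_orthogonal]
    exact congrArg₂ _ (S - z • (1 : K →L[ℂ] K)).orthogonal_range.symm
      (T - w • (1 : K →L[ℂ] K)).orthogonal_range.symm
  rw [Module.finrank_eq_rank, ← rank_orthogonal_eq_rank_quotient hcl, e]

theorem jointKer_comm [CompleteSpace K] (S T : K →L[ℂ] K) (z w : ℂ) :
    jointKer S T z w = jointKer T S w z :=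
  inf_comm _ _

end CokernelDimension

/-! ### Isopair structure and rank under restriction -/

section Restriction

variable {K : Type*} [NormedAddCommGroup K] [InnerProductSpace ℂ K]

theorem coe_restrictOp_pow_apply {S : K →L[ℂ] K} {H : Submodule ℂ K} (hS : ∀ x ∈ H, S x ∈ H)
    (n : ℕ) (x : H) : (((restrictOp S H hS) ^ n) x : K) = (S ^ n) x := by
  induction n generalizing x with
  | zero => simp
  | succ n ih =>
    rw [pow_succ, pow_succ, mul_apply_eq_comp, mul_apply_eq_comp, ih]
    rfl

theorem coe_polyEval_restrictOp_apply {S T : K →L[ℂ] K} {H : Submodule ℂ K}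
    (hS : ∀ x ∈ H, S x ∈ H) (hT : ∀ x ∈ H, T x ∈ H) (q : MvPolynomial (Fin 2) ℂ) (x : H) :
    (polyEval q (restrictOp S H hS) (restrictOp T H hT) x : K) = polyEval q S T x := by
  rw [polyEval_apply, polyEval_apply, Submodule.coe_sum]
  refine Finset.sum_congr rfl fun m _ => ?_
  rw [Submodule.coe_smul, coe_restrictOp_pow_apply, coe_restrictOp_pow_apply]

theorem IsPureIsometry.restrictOp {S : K →L[ℂ] K} (h : IsPureIsometry S) {H : Submodule ℂ K}
    (hS : ∀ x ∈ H, S x ∈ H) : IsPureIsometry (restrictOp S H hS) where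
  isometry := fun x y => h.isometry x y
  iInf_range_pow := by
    refine eq_bot_iff.2 fun x hx => ?_
    have hx' : (x : K) ∈ ⨅ n : ℕ, LinearMap.range ((S ^ n : K →L[ℂ] K) : K →ₗ[ℂ] K) := by
      rw [Submodule.mem_iInf] at hx ⊢
      intro n
      obtain ⟨y, hy⟩ := hx n
      refine ⟨y, ?_⟩
      rw [← hy]
      exact (coe_restrictOp_pow_apply hS n y).symm
    rw [h.iInf_range_pow] at hx'
    exact (Submodule.mem_bot ℂ).2 (Subtype.ext ((Submodule.mem_bot ℂ).1 hx'))

theorem commute_restrictOp {S T : K →L[ℂ] K} (h : Commute S T) {H : Submodule ℂ K}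
    (hS : ∀ x ∈ H, S x ∈ H) (hT : ∀ x ∈ H, T x ∈ H) :
    Commute (restrictOp S H hS) (restrictOp T H hT) := by
  ext x
  exact DFunLike.congr_fun h.eq (x : K)

theorem IsPureIsopair.restrictOp {p : MvPolynomial (Fin 2) ℂ} {S T : K →L[ℂ] K}
    (hV : IsPureIsopair p S T) {H : Submodule ℂ K} [FiniteDimensional ℂ (K ⧸ H)]
    (hS : ∀ x ∈ H, S x ∈ H) (hT : ∀ x ∈ H, T x ∈ H) :
    IsPureIsopair p (restrictOp S H hS) (restrictOp T H hT) where
  pure_left := hV.pure_left.restrictOp hS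
  pure_right := hV.pure_right.restrictOp hT
  commute := commute_restrictOp hV.commute hS hT
  annihilates := by
    ext x
    rw [coe_polyEval_restrictOp_apply, hV.annihilates]
    rfl
  minimal := by
    intro q hq
    apply hV.minimal
    have hH : H ≤ H.comap (S : K →ₗ[ℂ] K) := hS
    -- As `g(S)` maps `K` into `H`, a polynomial `q` vanishing on the restricted pair gives `g(S)
    -- q(S, T) = q(S, T) g(S) = 0`, and `g(S)` is injective.
    set g := minpoly ℂ (H.mapQ H (S : K →ₗ[ℂ] K) hH) with hg
    have hg0 : g ≠ 0 := minpoly.ne_zero (Algebra.IsIntegral.isIntegral _)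
    have hmem : ∀ v, Polynomial.aeval (S : Module.End ℂ K) g v ∈ H := fun v => by
      rw [← Submodule.Quotient.mk_eq_zero]
      have := aeval_mapQ_mkQ hH g v
      rw [minpoly.aeval] at this
      exact this.symm
    ext v
    apply hV.pure_left.injective_aeval hg0
    rw [← polyEval_aeval_apply hV.commute, zero_apply, map_zero]
    have := coe_polyEval_restrictOp_apply hS hT q ⟨_, hmem v⟩
    rw [hq] at this
    exact this.symm

theorem isoMult_restrictOp [CompleteSpace K] {S : K →L[ℂ] K} (h : Isometry S)
    (hm : isoMult S < Cardinal.aleph0) {H : Submodule ℂ K} [CompleteSpace H]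
    [FiniteDimensional ℂ (K ⧸ H)] (hS : ∀ x ∈ H, S x ∈ H) :
    isoMult (restrictOp S H hS) = isoMult S := by
  have h' : Isometry (restrictOp S H hS) := fun x y => h x y
  rw [isoMult_eq_rank_quotient h'] at *
  rw [isoMult_eq_rank_quotient h] at *
  have hfin : FiniteDimensional ℂ (K ⧸ LinearMap.range (S : K →ₗ[ℂ] K)) :=
    Module.rank_lt_aleph0_iff.1 hm
  have hι : FiniteDimensional ℂ (K ⧸ LinearMap.range H.subtype) := by
    rwa [Submodule.range_subtype]
  have hx : (S : K →ₗ[ℂ] K) ∘ₗ H.subtype =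
      H.subtype ∘ₗ (restrictOp S H hS : H →ₗ[ℂ] H) := rfl
  have hfin' := (eventually_finrank_ker_mapQ_pow_eq (y := 0) (y' := 0) H.subtype_injective hx
    (by simp) (Commute.zero_right _) (Commute.zero_right _) h.injective).1
  have e := finrank_quotient_range_eq H.subtype_injective hx h.injective
  rw [← Module.finrank_eq_rank, ← Module.finrank_eq_rank, e]

theorem rank_jointKer_restrictOp [CompleteSpace K] {S T : K →L[ℂ] K} (hS' : IsPureIsometry S)
    (hST : Commute S T) (hm : isoMult S < Cardinal.aleph0) {H : Submodule ℂ K} [CompleteSpace H]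
    [FiniteDimensional ℂ (K ⧸ H)] (hS : ∀ x ∈ H, S x ∈ H) (hT : ∀ x ∈ H, T x ∈ H)
    {z w : ℂ} (hz : ‖z‖ < 1) {P : Polynomial ℂ} (h0 : P.coeff 0 = 0) (h1 : P.coeff 1 ≠ 0)
    (hP : ∀ v, Polynomial.aeval ((T - w • (1 : K →L[ℂ] K) : K →L[ℂ] K) : Module.End ℂ K) P v ∈
      LinearMap.range ((S - z • (1 : K →L[ℂ] K) : K →L[ℂ] K) : K →ₗ[ℂ] K))
    (hP' : ∀ v, Polynomial.aeval
        ((restrictOp T H hT - w • (1 : H →L[ℂ] H) : H →L[ℂ] H) : Module.End ℂ H) P v ∈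
      LinearMap.range ((restrictOp S H hS - z • (1 : H →L[ℂ] H) : H →L[ℂ] H) : H →ₗ[ℂ] H)) :
    Module.rank ℂ (jointKer (restrictOp S H hS) (restrictOp T H hT) z w) =
      Module.rank ℂ (jointKer S T z w) := by
  rw [rank_jointKer_eq T hS'.isometry hm hz, rank_jointKer_eq (restrictOp T H hT)
    (hS'.restrictOp hS).isometry (by rwa [isoMult_restrictOp hS'.isometry hm hS]) hz]
  have hfin := finiteDimensional_quotient_range_sub_smul hS'.isometry hm hz
  have hι : FiniteDimensional ℂ (K ⧸ LinearMap.range H.subtype) := by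
    rwa [Submodule.range_subtype]
  have hcomm : ∀ v, S (T v) = T (S v) := fun v => DFunLike.congr_fun hST.eq v
  have key := finrank_quotient_sup_range_eq (ι := H.subtype)
    (x := ((S - z • (1 : K →L[ℂ] K) : K →L[ℂ] K) : K →ₗ[ℂ] K))
    (y := ((T - w • (1 : K →L[ℂ] K) : K →L[ℂ] K) : K →ₗ[ℂ] K))
    (x' := ((restrictOp S H hS - z • (1 : H →L[ℂ] H) : H →L[ℂ] H) : H →ₗ[ℂ] H))
    (y' := ((restrictOp T H hT - w • (1 : H →L[ℂ] H) : H →L[ℂ] H) : H →ₗ[ℂ] H))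
    H.subtype_injective rfl rfl
    (LinearMap.ext fun v => by simp [hcomm, smul_sub, smul_smul, mul_comm z w]; abel)
    (LinearMap.ext fun v => Subtype.ext (by
      simp [restrictOp, hcomm, smul_sub, smul_smul, mul_comm z w]; abel))
    (hS'.injective_sub_smul z) h0 h1 hP hP'
  rw [key]

theorem HasRank.restrictOp [CompleteSpace K] {s : ℕ} {pf : Fin s → MvPolynomial (Fin 2) ℂ}
    {α : Fin s → ℕ} {S T : K →L[ℂ] K} (hV : IsPureIsopair (∏ j, pf j) S T)
    (hfin : HasFiniteBimultiplicity S T) (h : HasRank pf α S T) {H : Submodule ℂ K}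
    [CompleteSpace H] [FiniteDimensional ℂ (K ⧸ H)]
    (hS : ∀ x ∈ H, S x ∈ H) (hT : ∀ x ∈ H, T x ∈ H) :
    HasRank pf α (restrictOp S H hS) (restrictOp T H hT) where
  pos := h.pos
  mult_right := by rw [isoMult_restrictOp hV.pure_right.isometry hfin.2, h.mult_right]
  mult_left := by rw [isoMult_restrictOp hV.pure_left.isometry hfin.1, h.mult_left]
  dim_eq := by
    rintro j ⟨z, w⟩ hx hreg
    rw [← h.dim_eq j (z, w) hx hreg]
    have hW := (hV.restrictOp hS hT).annihilates
    obtain ⟨hp0, hp | hp⟩ := hreg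
    -- Here the `z`-derivative is nonzero, so `S - z` acts on the cokernel of `T - w`.
    · rw [jointKer_comm, jointKer_comm S T]
      refine rank_jointKer_restrictOp hV.pure_right hV.commute.symm hfin.2 hT hS hx.2.2 ?_ ?_
        (aeval_mem_range_right hV.commute hV.annihilates z w)
        (aeval_mem_range_right (commute_restrictOp hV.commute hS hT) hW z w)
      · rw [coeff_zero_aeval, ← hp0]
        congr 2
        ext i
        fin_cases i <;> simp
      · rw [coeff_one_aeval]
        have e : (fun i => ((![Polynomial.X + Polynomial.C z, Polynomial.C w] :
            Fin 2 → Polynomial ℂ) i).coeff 0) = ![z, w] := by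
          ext i
          fin_cases i <;> simp
        simpa [e, Polynomial.coeff_C] using hp
    · refine rank_jointKer_restrictOp hV.pure_left hV.commute hfin.1 hS hT hx.2.1 ?_ ?_
        (aeval_mem_range_left hV.annihilates z w) (aeval_mem_range_left hW z w)
      · rw [coeff_zero_aeval, ← hp0]
        congr 2
        ext i
        fin_cases i <;> simp
      · rw [coeff_one_aeval]
        have e : (fun i => ((![Polynomial.C z, Polynomial.X + Polynomial.C w] :
            Fin 2 → Polynomial ℂ) i).coeff 0) = ![z, w] := by
          ext i
          fin_cases i <;> simp
        simpa [e, Polynomial.coeff_C] using hp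

end Restriction

/-! ### Cyclic vectors bound joint eigenspaces -/

section Cyclicity

variable {K : Type*} [NormedAddCommGroup K] [InnerProductSpace ℂ K]

theorem inner_pow_apply_of_adjoint_eq [CompleteSpace K] {S : K →L[ℂ] K} {v : K} {z : ℂ}
    (h : ContinuousLinearMap.adjoint (S - z • (1 : K →L[ℂ] K)) v = 0) (n : ℕ) (x : K) :
    inner ℂ v ((S ^ n) x) = z ^ n * inner ℂ v x := by
  have h1 : ∀ x, inner ℂ v (S x) = z * inner ℂ v x := by
    intro x
    have e := ContinuousLinearMap.adjoint_inner_left (S - z • (1 : K →L[ℂ] K)) x v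
    rw [h, inner_zero_left] at e
    have e' : (S - z • (1 : K →L[ℂ] K)) x = S x - z • x := by simp
    rw [e', inner_sub_right, inner_smul_right] at e
    exact (sub_eq_zero.1 e.symm)
  induction n with
  | zero => simp
  | succ n ih => rw [pow_succ', mul_apply_eq_comp, h1, ih, pow_succ']; ring

theorem HasCyclicVectors.rank_jointKer_le [CompleteSpace K] {S T : K →L[ℂ] K} {k : ℕ}
    (h : HasCyclicVectors S T k) (z w : ℂ) :
    Module.rank ℂ (jointKer S T z w) ≤ (k : Cardinal) := by
  obtain ⟨f, hf⟩ := h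
  let F : K →ₗ[ℂ] (Fin k → ℂ) := LinearMap.pi fun i => ((innerSL ℂ (f i) : K →L[ℂ] ℂ) : K →ₗ[ℂ] ℂ)
  have hinj : Function.Injective (F ∘ₗ (jointKer S T z w).subtype) := by
    rw [injective_iff_map_eq_zero]
    rintro ⟨v, hv₁, hv₂⟩ h0
    have hvf : ∀ i, inner ℂ v (f i) = 0 := fun i => by
      have e : inner ℂ (f i) v = 0 := congrFun h0 i
      rw [← inner_conj_symm, e, map_zero]
    -- For a joint eigenvector `v` of the adjoints, `⟪v, q(S, T) f i⟫ = q(z, w) ⟪v, f i⟫`, so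
    -- orthogonality to the generators passes to their span.
    have hle : polySpan S T f ≤ (ℂ ∙ v)ᗮ := by
      rintro _ ⟨q, rfl⟩
      rw [Submodule.mem_orthogonal_singleton_iff_inner_right, inner_sum]
      refine Finset.sum_eq_zero fun j _ => ?_
      rw [polyEval_apply, inner_sum]
      refine Finset.sum_eq_zero fun m _ => ?_
      rw [inner_smul_right, inner_pow_apply_of_adjoint_eq hv₁, inner_pow_apply_of_adjoint_eq hv₂,
        hvf]
      ring
    have htop := Submodule.topologicalClosure_minimal _ hle (Submodule.isClosed_orthogonal _)
    rw [hf] at htop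
    have hvv := htop (Submodule.mem_top : v ∈ ⊤)
    rw [Submodule.mem_orthogonal_singleton_iff_inner_right, inner_self_eq_zero] at hvv
    exact Subtype.ext hvv
  simpa using LinearMap.lift_rank_le_of_injective _ hinj

theorem HasRank.not_hasCyclicVectors [CompleteSpace K] {s : ℕ}
    {pf : Fin s → MvPolynomial (Fin 2) ℂ} {α : Fin s → ℕ} {S T : K →L[ℂ] K}
    (hsq : Squarefree (∏ j, pf j)) (ht : IsInnerToral (∏ j, pf j))
    (hirr : ∀ j, Irreducible (pf j)) (h : HasRank pf α S T) {γ : ℕ}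
    (hγ : γ < Finset.univ.sup α) : ¬ HasCyclicVectors S T γ := by
  intro hc
  obtain ⟨j, -, hj⟩ := (Finset.lt_sup_iff).1 hγ
  obtain ⟨x, hx, hreg⟩ := exists_isRegularPoint hsq ht hirr j
  have e := hc.rank_jointKer_le x.1 x.2
  rw [h.dim_eq j x hx hreg] at e
  exact absurd (Nat.cast_le.1 e) (not_le.2 hj)

theorem polyEval_monomial (m : Fin 2 →₀ ℕ) (c : ℂ) (S T : K →L[ℂ] K) :
    polyEval (MvPolynomial.monomial m c) S T = c • (S ^ m 0 * T ^ m 1) := by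
  rw [polyEval_eq_sum _ S T (MvPolynomial.support_monomial_subset), Finset.sum_singleton,
    MvPolynomial.coeff_monomial, if_pos rfl]

theorem polyEval_X_zero_mul (q : MvPolynomial (Fin 2) ℂ) (S T : K →L[ℂ] K) :
    polyEval (MvPolynomial.X 0 * q) S T = S * polyEval q S T := by
  induction q using MvPolynomial.induction_on' with
  | monomial m c =>
    rw [MvPolynomial.X, MvPolynomial.monomial_mul, polyEval_monomial, polyEval_monomial, one_mul]
    simp [pow_add, mul_assoc]
  | add p q hp hq => rw [mul_add, polyEval_add, polyEval_add, hp, hq, mul_add]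

theorem polyEval_X_one_mul (q : MvPolynomial (Fin 2) ℂ) {S T : K →L[ℂ] K} (h : Commute S T) :
    polyEval (MvPolynomial.X 1 * q) S T = T * polyEval q S T := by
  induction q using MvPolynomial.induction_on' with
  | monomial m c =>
    rw [MvPolynomial.X, MvPolynomial.monomial_mul, polyEval_monomial, polyEval_monomial, one_mul]
    simp [pow_add, ← mul_assoc, (h.pow_left (m 0)).eq]
  | add p q hp hq => rw [mul_add, polyEval_add, polyEval_add, hp, hq, mul_add]

theorem apply_left_mem_polySpan {S T : K →L[ℂ] K} {k : ℕ} {f : Fin k → K} {x : K}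
    (hx : x ∈ polySpan S T f) : S x ∈ polySpan S T f := by
  obtain ⟨q, rfl⟩ := hx
  exact ⟨fun j => MvPolynomial.X 0 * q j, by simp [polyEval_X_zero_mul]⟩

theorem apply_right_mem_polySpan {S T : K →L[ℂ] K} (h : Commute S T) {k : ℕ} {f : Fin k → K}
    {x : K} (hx : x ∈ polySpan S T f) : T x ∈ polySpan S T f := by
  obtain ⟨q, rfl⟩ := hx
  exact ⟨fun j => MvPolynomial.X 1 * q j, by simp [polyEval_X_one_mul _ h]⟩

theorem apply_mem_polySpan_self (S T : K →L[ℂ] K) {k : ℕ} (f : Fin k → K) (i : Fin k) :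
    f i ∈ polySpan S T f := by
  refine ⟨fun j => if j = i then 1 else 0, ?_⟩
  have h1 : polyEval 1 S T = 1 := by
    have := polyEval_monomial 0 1 S T
    simpa using this
  have h0 : polyEval 0 S T = 0 := by simp [polyEval]
  rw [Finset.sum_eq_single i (fun j _ hj => by simp [hj, h0]) (by simp)]
  simp [h1]

/-- Vectors are cyclic for the restriction to the closed invariant subspace they generate. -/
theorem hasCyclicVectors_restrictOp {S T : K →L[ℂ] K} {k : ℕ} (f : Fin k → K)
    (hS : ∀ x ∈ (polySpan S T f).topologicalClosure, S x ∈ (polySpan S T f).topologicalClosure)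
    (hT : ∀ x ∈ (polySpan S T f).topologicalClosure, T x ∈ (polySpan S T f).topologicalClosure) :
    HasCyclicVectors (restrictOp S _ hS) (restrictOp T _ hT) k := by
  set H := (polySpan S T f).topologicalClosure with hH
  refine ⟨fun i => ⟨f i, Submodule.le_topologicalClosure _ (apply_mem_polySpan_self S T f i)⟩, ?_⟩
  rw [Submodule.eq_top_iff']
  intro x
  rw [← SetLike.mem_coe, Submodule.topologicalClosure_coe, closure_subtype]
  refine closure_mono ?_ x.2
  rintro _ ⟨q, rfl⟩
  refine ⟨_, ⟨q, rfl⟩, ?_⟩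
  rw [Submodule.coe_sum]
  exact Finset.sum_congr rfl fun j _ => coe_polyEval_restrictOp_apply hS hT (q j) _

end Cyclicity

theorem proposition3p7 {K : Type*} [NormedAddCommGroup K] [InnerProductSpace ℂ K]
    [CompleteSpace K] {s : ℕ} (p : MvPolynomial (Fin 2) ℂ)
    (pf : Fin s → MvPolynomial (Fin 2) ℂ)
    (hsq : Squarefree p) (htoral : IsInnerToral p)
    (hirr : ∀ j, Irreducible (pf j)) (hfac : p = ∏ j, pf j)
    (S T : K →L[ℂ] K) (hV : IsPureIsopair p S T) (hfin : HasFiniteBimultiplicity S T)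
    (α : Fin s → ℕ) (hrank : HasRank pf α S T) :
    (∀ (H : Submodule ℂ K) [CompleteSpace H] -- equivalently, `H` is closed
       
        (hS : ∀ x ∈ H, S x ∈ H) (hT : ∀ x ∈ H, T x ∈ H),
      FiniteDimensional ℂ (K ⧸ H) →
        IsPureIsopair p (restrictOp S H hS) (restrictOp T H hT) ∧
        HasFiniteBimultiplicity (restrictOp S H hS) (restrictOp T H hT) ∧
        HasRank pf α (restrictOp S H hS) (restrictOp T H hT) ∧
        IsAtLeastMultiCyclic (restrictOp S H hS) (restrictOp T H hT) (Finset.univ.sup α)) ∧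
    IsAtLeastNearlyMultiCyclic S T (Finset.univ.sup α) := by
  subst hfac
  -- Excluding any `γ` cyclic vectors, minimal in number or not, is what the second claim needs:
  -- nothing is known there about fewer vectors being cyclic for the restriction.
  have restr : ∀ (H : Submodule ℂ K) [CompleteSpace H] (hS : ∀ x ∈ H, S x ∈ H)
      (hT : ∀ x ∈ H, T x ∈ H), FiniteDimensional ℂ (K ⧸ H) → ∀ γ < Finset.univ.sup α,
      ¬ HasCyclicVectors (restrictOp S H hS) (restrictOp T H hT) γ :=
    fun H _ hS hT _ γ hγ =>
      (hrank.restrictOp hV hfin hS hT).not_hasCyclicVectors hsq htoral hirr hγ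
  refine ⟨fun H _ hS hT hH => ⟨hV.restrictOp hS hT, ⟨?_, ?_⟩, hrank.restrictOp hV hfin hS hT,
    fun γ hγ h => restr H hS hT hH γ hγ h.1⟩, ?_⟩
  · rw [isoMult_restrictOp hV.pure_left.isometry hfin.1]
    exact hfin.1
  · rw [isoMult_restrictOp hV.pure_right.isometry hfin.2]
    exact hfin.2
  · rintro γ hγ ⟨⟨f, hf⟩, -⟩
    have hS : ∀ x ∈ (polySpan S T f).topologicalClosure,
        S x ∈ (polySpan S T f).topologicalClosure := fun x hx =>
      map_mem_closure S.continuous hx fun y hy => apply_left_mem_polySpan hy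
    have hT : ∀ x ∈ (polySpan S T f).topologicalClosure,
        T x ∈ (polySpan S T f).topologicalClosure := fun x hx =>
      map_mem_closure T.continuous hx fun y hy => apply_right_mem_polySpan hV.commute hy
    have : CompleteSpace (polySpan S T f).topologicalClosure :=
      (polySpan S T f).isClosed_topologicalClosure.completeSpace_coe
    exact restr _ hS hT hf γ hγ (hasCyclicVectors_restrictOp f hS hT)
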